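/- Call a triangulated category $\mathcal C$ connected if $\mathcal C \neq 0$ and, whenever $\mathcal C = \mathcal C_1 \oplus \mathcal C_2$ with $\mathcal C_1, \mathcal C_2$ triangulated subcategories of $\mathcal C$, either $\mathcal C_1 = 0$ or $\mathcal C_2 = 0$. Here $\mathcal C_1 \oplus \mathcal C_2$ is the category whose objects are the direct sums $U \oplus V$ with $U \in \mathcal C_1$, $V \in \mathcal C_2$, with $\operatorname{Hom}(U_1 \oplus V_1, U_2 \oplus V_2) = \operatorname{Hom}_{\mathcal C_1}(U_1, U_2) \oplus \operatorname{Hom}_{\mathcal C_2}(V_1, V_2)$. **Proposition.** Let $(A, \mathfrak m)$ be a commutative Noetherian local ring, and let $D^b(\operatorname{mod}(A))$ be the bounded derived category of the abelian category $\operatorname{mod}(A)$ of finitely generated $A$-modules. Then the triangulated category $D^b(\operatorname{mod}(A))$ is connected. -/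

import Mathlib

open CategoryTheory CategoryTheory.Limits CategoryTheory.Pretriangulated

universe w v u

section TriangulatedConnectedness

variable {C : Type u} [Category.{v} C] [HasZeroObject C] [HasShift C ℤ] [Preadditive C]
  [∀ n : ℤ, (shiftFunctor C n).Additive] [Pretriangulated C]

/-- The functor `(U, V) ↦ U ⊞ V` to `C` from the direct sum `P ⊕ Q` of two full subcategories
of `C`. The objects of this direct sum are the pairs `(U, V)` with `U` in `P` and `V` in `Q`, and
`Hom((U₁, V₁), (U₂, V₂)) = Hom(U₁, U₂) × Hom(V₁, V₂)`: this is the product category. -/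
noncomputable def directSumFunctor (P Q : ObjectProperty C) :
    P.FullSubcategory × Q.FullSubcategory ⥤ C where
  obj X := biprod X.1.obj X.2.obj
  map f := biprod.map f.1.hom f.2.hom

/-- The triangulated category `C` is the direct sum of its full triangulated subcategories
`P` and `Q`: the functor `P ⊕ Q ⥤ C`, `(U, V) ↦ U ⊞ V`, is an equivalence of categories. (It
always commutes with the shift and preserves distinguished triangles, because the shift, the
zero objects and the triangles of `P` and of `Q` are those of `C`.) -/
structure IsTriangulatedDirectSum (P Q : ObjectProperty C) : Prop where
  isTriangulated_left : P.IsTriangulated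
  isTriangulated_right : Q.IsTriangulated
  isEquivalence : (directSumFunctor P Q).IsEquivalence

variable (C)

/-- A triangulated category `C` is connected if it is nonzero and if, whenever it is the direct
sum of two triangulated subcategories, one of the two is zero. -/
structure IsConnectedTriangulated [IsTriangulated C] : Prop where
  exists_not_isZero : ∃ X : C, ¬ IsZero X
  eq_zero_or_eq_zero (P Q : ObjectProperty C) (h : IsTriangulatedDirectSum P Q) :
    (∀ X, P X → IsZero X) ∨ (∀ X, Q X → IsZero X)

end TriangulatedConnectedness

/-! Let `S` be the residue field, placed in degree zero. Its nonzero endomorphisms are invertible,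
so `S` is indecomposable and, up to isomorphism, lies in one summand with all its shifts; the other
summand then has no nonzero map to any shift of `S`. But a nonzero bounded `Y` always has one: its
top cohomology is a nonzero finitely generated module, hence maps onto the residue field. So the
other summand is zero. -/

section DirectSum

variable {C : Type u} [Category.{v} C] [HasZeroObject C] [HasShift C ℤ] [Preadditive C]
  [∀ n : ℤ, (shiftFunctor C n).Additive] [Pretriangulated C]

namespace IsTriangulatedDirectSum

variable {P Q : ObjectProperty C}

/-- The decomposition of an object in a direct sum of triangulated subcategories. -/
lemma exists_iso_biprod (h : IsTriangulatedDirectSum P Q) (X : C) :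
    ∃ (U V : C), P U ∧ Q V ∧ Nonempty (X ≅ U ⊞ V) := by
  have := h.isEquivalence
  exact ⟨_, _, ((directSumFunctor P Q).objPreimage X).1.property,
    ((directSumFunctor P Q).objPreimage X).2.property,
    ⟨((directSumFunctor P Q).objObjPreimageIso X).symm⟩⟩

/-- There are no nonzero morphisms from the first summand to the second one. -/
lemma hom_left_right_eq_zero (h : IsTriangulatedDirectSum P Q) {U V : C} (hU : P U) (hV : Q V)
    (f : U ⟶ V) : f = 0 := by
  have := h.isEquivalence
  have := h.isTriangulated_left
  have := h.isTriangulated_right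
  -- Padding by `Z` and `W` makes `f` an off-diagonal entry of a map of biproducts; by fullness such
  -- a map is diagonal.
  obtain ⟨Z, -, hPZ⟩ := P.exists_prop_of_containsZero
  obtain ⟨W, -, hQW⟩ := Q.exists_prop_of_containsZero
  obtain ⟨g, hg⟩ := (directSumFunctor P Q).map_surjective
    (X := (⟨U, hU⟩, ⟨W, hQW⟩)) (Y := (⟨Z, hPZ⟩, ⟨V, hV⟩))
    (biprod.fst ≫ f ≫ biprod.inr)
  have h₁ : biprod.map g.1.hom g.2.hom = biprod.fst ≫ f ≫ biprod.inr := hg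
  calc f = biprod.inl ≫ (biprod.fst ≫ f ≫ biprod.inr : U ⊞ W ⟶ Z ⊞ V) ≫ biprod.snd := by simp
    _ = 0 := by rw [← h₁]; simp

/-- There are no nonzero morphisms from the second summand to the first one. -/
lemma hom_right_left_eq_zero (h : IsTriangulatedDirectSum P Q) {U V : C} (hU : P U) (hV : Q V)
    (f : V ⟶ U) : f = 0 := by
  have := h.isEquivalence
  have := h.isTriangulated_left
  have := h.isTriangulated_right
  obtain ⟨Z, -, hPZ⟩ := P.exists_prop_of_containsZero
  obtain ⟨W, -, hQW⟩ := Q.exists_prop_of_containsZero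
  obtain ⟨g, hg⟩ := (directSumFunctor P Q).map_surjective
    (X := (⟨Z, hPZ⟩, ⟨V, hV⟩)) (Y := (⟨U, hU⟩, ⟨W, hQW⟩))
    (biprod.snd ≫ f ≫ biprod.inl)
  have h₁ : biprod.map g.1.hom g.2.hom = biprod.snd ≫ f ≫ biprod.inl := hg
  calc f = biprod.inr ≫ (biprod.snd ≫ f ≫ biprod.inl : Z ⊞ V ⟶ U ⊞ W) ≫ biprod.fst := by simp
    _ = 0 := by rw [← h₁]; simp

end IsTriangulatedDirectSum

/-- If the nonzero endomorphisms of `X` are invertible, then one of the summands in any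
decomposition of `X` is zero. -/
lemma isZero_or_isZero_of_iso_biprod {X U V : C} (hX : ∀ f : X ⟶ X, f ≠ 0 → IsIso f)
    (e : X ≅ U ⊞ V) : IsZero U ∨ IsZero V := by
  -- The two idempotents of the decomposition compose to zero, so if one is invertible the other
  -- vanishes.
  have key : (e.hom ≫ biprod.fst ≫ biprod.inl ≫ e.inv) ≫
      (e.hom ≫ biprod.snd ≫ biprod.inr ≫ e.inv) = 0 := by simp
  by_cases h : e.hom ≫ biprod.fst ≫ biprod.inl ≫ e.inv = 0
  · left
    rw [IsZero.iff_id_eq_zero]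
    calc 𝟙 U = biprod.inl ≫ e.inv ≫ (e.hom ≫ biprod.fst ≫ biprod.inl ≫ e.inv) ≫
          e.hom ≫ biprod.fst := by simp
      _ = 0 := by rw [h]; simp
  · right
    have := hX _ h
    have h' : e.hom ≫ biprod.snd ≫ biprod.inr ≫ e.inv = 0 := by
      rwa [← cancel_epi (e.hom ≫ biprod.fst ≫ biprod.inl ≫ e.inv), comp_zero]
    rw [IsZero.iff_id_eq_zero]
    calc 𝟙 V = biprod.inr ≫ e.inv ≫ (e.hom ≫ biprod.snd ≫ biprod.inr ≫ e.inv) ≫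
          e.hom ≫ biprod.snd := by simp
      _ = 0 := by rw [h']; simp

end DirectSum

namespace CategoryTheory.Triangulated.TStructure

variable {C : Type u} [Category.{v} C] [Preadditive C] [HasZeroObject C] [HasShift C ℤ]
  [∀ n : ℤ, (shiftFunctor C n).Additive] [Pretriangulated C]

/-- A nonzero bounded object is concentrated in degrees at most `n` for a least `n`. -/
lemma exists_isLE_not_isLE_sub_one (t : TStructure C) {X : C} (hX : t.bounded X)
    (h₀ : ¬ IsZero X) : ∃ n : ℤ, t.IsLE X n ∧ ¬ t.IsLE X (n - 1) := by
  obtain ⟨⟨a, ha⟩, ⟨b, hb⟩⟩ := hX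
  obtain ⟨n, hn, hmin⟩ := Int.exists_least_of_bdd (P := fun n ↦ t.IsLE X n)
    ⟨a, fun z hz ↦ by
      by_contra! hlt
      exact h₀ (t.isZero X z a hlt)⟩ ⟨b, hb⟩
  exact ⟨n, hn, fun h ↦ by have := hmin _ h; lia⟩

end CategoryTheory.Triangulated.TStructure

namespace DerivedCategory

open TStructure

variable {C : Type u} [Category.{v} C] [Abelian C] [HasDerivedCategory.{w} C]

/-- If every nonzero object of `C` maps nontrivially to `S`, then every nonzero bounded object
of the derived category maps nontrivially to `S` placed in some degree. -/
lemma exists_hom_singleFunctor_ne_zero {S : C}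
    (hS : ∀ M : C, ¬ IsZero M → ∃ f : M ⟶ S, f ≠ 0) {Y : DerivedCategory C}
    (hY : (t (C := C)).bounded Y) (h₀ : ¬ IsZero Y) :
    ∃ (n : ℤ) (f : Y ⟶ (singleFunctor C n).obj S), f ≠ 0 := by
  obtain ⟨n, hn, hn'⟩ := t.exists_isLE_not_isLE_sub_one hY h₀
  -- By minimality of `n`, the truncation in degrees `≥ n` is nonzero; it is concentrated in degree
  -- `n`.
  rw [t.isLE_iff_isZero_truncGE_obj (n - 1) n (by lia)] at hn'
  obtain ⟨M, ⟨e⟩⟩ := exists_iso_singleFunctor_obj_of_isGE_of_isLE ((t.truncGE n).obj Y) n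
  obtain ⟨f, hf⟩ := hS M fun hM ↦ hn' (((singleFunctor C n).map_isZero hM).of_iso e)
  refine ⟨n, (t.truncGEπ n).app Y ≫ e.hom ≫ (singleFunctor C n).map f, fun h ↦ hf ?_⟩
  have h₁ : e.hom ≫ (singleFunctor C n).map f = 0 :=
    t.from_truncGE_obj_ext (by rw [h, comp_zero])
  apply (singleFunctor C n).map_injective
  rw [← cancel_epi e.hom, h₁, Functor.map_zero, comp_zero]

variable (C) in
/-- The object of the bounded derived category given by an object of `C` in degree zero. -/
noncomputable def Bounded.single (S : C) : Bounded C :=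
  ⟨(singleFunctor C 0).obj S, ⟨0, inferInstance⟩, ⟨0, inferInstance⟩⟩

/-- An endomorphism of an object in degree zero is invertible if nonzero, when this holds in `C`. -/
lemma Bounded.isIso_of_end_single {S : C} (hS : ∀ f : S ⟶ S, f ≠ 0 → IsIso f)
    (f : Bounded.single C S ⟶ Bounded.single C S) (hf : f ≠ 0) : IsIso f := by
  obtain ⟨g, hg⟩ := (singleFunctor C 0).map_surjective f.hom
  have : IsIso g := hS g fun h ↦ hf (by
    ext
    rw [← hg, h, Functor.map_zero]
    rfl)
  have : IsIso (Bounded.ι.map f) := by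
    change IsIso f.hom
    rw [← hg]
    exact Functor.map_isIso (singleFunctor C 0) g
  exact isIso_of_fully_faithful Bounded.ι f

/-- If every nonzero object of `C` maps nontrivially to `S`, then every nonzero object of the
bounded derived category maps nontrivially to a shift of `S`. -/
lemma Bounded.exists_hom_shift_single_ne_zero {S : C}
    (hS : ∀ M : C, ¬ IsZero M → ∃ f : M ⟶ S, f ≠ 0) {Y : Bounded C} (h₀ : ¬ IsZero Y) :
    ∃ (n : ℤ) (f : Y ⟶ (Bounded.single C S)⟦n⟧), f ≠ 0 := by
  obtain ⟨n, f, hf⟩ := exists_hom_singleFunctor_ne_zero hS Y.property fun h ↦ h₀ (by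
    rw [IsZero.iff_id_eq_zero] at h ⊢
    ext
    exact h)
  -- Cohomological convention: `S` in degree `n` is the shift by `-n`.
  let e : (singleFunctor C n).obj S ≅ Bounded.ι.obj ((Bounded.single C S)⟦-n⟧) :=
    (((singleFunctors C).shiftIso (-n) n 0 (by lia)).app S).symm ≪≫
      ((Bounded.ι.commShiftIso (-n)).app (Bounded.single C S)).symm
  refine ⟨-n, Bounded.ι.preimage (f ≫ e.hom), fun h ↦ hf ?_⟩
  rw [← cancel_mono e.hom, zero_comp, ← Bounded.ι.map_preimage (f ≫ e.hom), h, Functor.map_zero]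

/-- The bounded derived category of an abelian category `C` is connected when `C` has a nonzero
object `S` whose nonzero endomorphisms are invertible and such that every nonzero object of `C`
maps nontrivially to `S`. -/
theorem Bounded.isConnectedTriangulated {S : C} (hS₀ : ¬ IsZero S)
    (hS : ∀ f : S ⟶ S, f ≠ 0 → IsIso f) (hS' : ∀ M : C, ¬ IsZero M → ∃ f : M ⟶ S, f ≠ 0) :
    IsConnectedTriangulated (Bounded C) where
  exists_not_isZero := by
    refine ⟨Bounded.single C S, fun h ↦ hS₀ ?_⟩
    have h' : IsZero ((singleFunctor C 0).obj S) := Bounded.ι.map_isZero h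
    rw [IsZero.iff_id_eq_zero] at h' ⊢
    apply (singleFunctor C 0).map_injective
    rw [CategoryTheory.Functor.map_id, h', Functor.map_zero]
  eq_zero_or_eq_zero P Q h := by
    have := h.isTriangulated_left
    have := h.isTriangulated_right
    obtain ⟨U, V, hU, hV, ⟨e⟩⟩ := h.exists_iso_biprod (Bounded.single C S)
    obtain hU₀ | hV₀ := isZero_or_isZero_of_iso_biprod (Bounded.isIso_of_end_single hS) e
    · left
      intro X hX
      by_contra hX₀
      obtain ⟨n, f, hf⟩ := Bounded.exists_hom_shift_single_ne_zero hS' hX₀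
      -- Membership in `Q` is known for `V`, so `f` is transported along `e'`.
      let e' : Bounded.single C S ≅ V := e ≪≫ (isoZeroBiprod hU₀).symm
      refine hf ?_
      rw [← cancel_mono ((shiftFunctor _ n).map e'.hom), zero_comp]
      exact h.hom_left_right_eq_zero hX (Q.le_shift n _ hV) _
    · right
      intro X hX
      by_contra hX₀
      obtain ⟨n, f, hf⟩ := Bounded.exists_hom_shift_single_ne_zero hS' hX₀
      let e' : Bounded.single C S ≅ U := e ≪≫ (isoBiprodZero hV₀).symm
      refine hf ?_
      rw [← cancel_mono ((shiftFunctor _ n).map e'.hom), zero_comp]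
      exact h.hom_right_left_eq_zero (P.le_shift n _ hU) hX _

end DerivedCategory

namespace FGModuleCat

variable {A : Type u} [CommRing A]

/-- Schur's lemma for finitely generated modules. -/
lemma isIso_of_end_of_isSimpleModule {S : FGModuleCat.{u} A} [IsSimpleModule A S] (f : S ⟶ S)
    (hf : f ≠ 0) : IsIso f := by
  have hb : Function.Bijective f.hom.hom :=
    (LinearMap.bijective_or_eq_zero f.hom.hom).resolve_right fun h ↦ hf (by ext1; exact h)
  exact (LinearEquiv.ofBijective f.hom.hom hb).toFGModuleCatIso.isIso_hom

/-- Over a local ring, nonzero finitely generated modules map nontrivially to the residue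
field. -/
lemma exists_hom_quotient_maximalIdeal_ne_zero [IsLocalRing A] (M : FGModuleCat.{u} A)
    (hM : ¬ IsZero M) : ∃ f : M ⟶ of A (A ⧸ IsLocalRing.maximalIdeal A), f ≠ 0 := by
  have : Nontrivial M := by
    by_contra h
    rw [not_nontrivial_iff_subsingleton] at h
    refine hM ((IsZero.iff_id_eq_zero M).2 ?_)
    ext x
    exact Subsingleton.elim _ _
  -- Finite generation gives a maximal submodule; the quotient is simple, hence the residue field as
  -- `A` is local.
  obtain ⟨N, hN⟩ := (eq_top_or_exists_le_coatom (⊥ : Submodule A M)).resolve_left bot_ne_top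
  obtain ⟨m, hm, ⟨e⟩⟩ := isSimpleModule_iff_quot_maximal.mp
    (isSimpleModule_iff_isCoatom.mpr hN.1)
  obtain rfl := IsLocalRing.eq_maximalIdeal hm
  refine ⟨ofHom (e.toLinearMap ∘ₗ N.mkQ), fun h ↦ hN.1.1 ?_⟩
  have h₁ : e.toLinearMap ∘ₗ N.mkQ = 0 := congr_arg (fun g ↦ g.hom.hom) h
  rw [eq_top_iff]
  intro x _
  have h₂ : e (N.mkQ x) = 0 := LinearMap.congr_fun h₁ x
  simpa using h₂

end FGModuleCat

theorem proposition4p3 (A : Type u) [CommRing A] [IsNoetherianRing A] [IsLocalRing A]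
    [HasDerivedCategory.{w} (FGModuleCat.{u} A)] :
    IsConnectedTriangulated (DerivedCategory.Bounded (FGModuleCat.{u} A)) := by
  let S : FGModuleCat.{u} A := FGModuleCat.of A (A ⧸ IsLocalRing.maximalIdeal A)
  have hS : IsSimpleModule A S :=
    isSimpleModule_iff_quot_maximal.mpr ⟨_, inferInstance, ⟨LinearEquiv.refl _ _⟩⟩
  have : Nontrivial S := IsSimpleModule.nontrivial A S
  refine DerivedCategory.Bounded.isConnectedTriangulated (S := S) (fun h ↦ ?_)
    FGModuleCat.isIso_of_end_of_isSimpleModule FGModuleCat.exists_hom_quotient_maximalIdeal_ne_zero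
  obtain ⟨x, hx⟩ := exists_ne (0 : S)
  exact hx (LinearMap.congr_fun (congr_arg (fun g ↦ g.hom.hom)
    ((IsZero.iff_id_eq_zero S).1 h)) x)
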